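/- Let $\mathbb F_q$ be the finite field with $q$ elements and let $P\in\mathbb F_q[x,y]$ satisfy $P(0,0)=0$ and $\frac{\partial P}{\partial y}(0,0)\neq 0$. Let $h=\deg_x P$ (the height of $P$) and $d=\deg_y P$ (the degree of $P$). Let $F=\sum_{n\ge 0}a(n)x^n\in\mathbb F_q[[x]]$ be the Furstenberg series associated with $P$, that is, the unique power series with $F(0)=0$ and $P(x,F)=0$, and assume $F\neq 0$ (so that $h,d\ge 1$). Consider finite deterministic automata with output that read base-$q$ representations of integers starting with the least significant digit. The minimal $q$-automaton of $a(n)_{n\ge 0}$ is the automaton with the fewest states among those that output $a(n)$ when fed the standard base-$q$ representation of $n$ (for every $n\ge 0$) and whose output is not affected by leading zeros. The $q$-kernel of $a(n)_{n\ge0}$ is the set of sequences $\{a(q^e n+r)_{n\ge 0} : e\ge 0,\ 0\le r\le q^e-1\}$. For positive integers $l,m,n$ let $$\mathcal L(l,m,n)=\max_{1\le i\le l,\ 1\le j\le m,\ 1\le k\le n}\ \max_{\sigma_1,\sigma_2,\sigma_3}\ \operatorname{lcm}\bigl(\operatorname{lcm}(\sigma_1),\operatorname{lcm}(\sigma_2),\operatorname{lcm}(\sigma_3)\bigr),$$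 where $\sigma_1,\sigma_2,\sigma_3$ run over the integer partitions of $i,j,k$ respectively, and $\operatorname{lcm}(\sigma)$ is the least common multiple of the parts of $\sigma$. Then a minimal $q$-automaton of $a(n)_{n\ge 0}$ exists, its number of states equals the number of elements of the $q$-kernel of $a(n)_{n\ge 0}$, and this number is at most $$q^{hd}+q^{(h-1)(d-1)}\,\mathcal L(h,d,d)+\lfloor\log_q h\rfloor+\lceil\log_q\max(h,d-1)\rceil+3.$$ -/

import Mathlib

/-- The height `deg_x P` of `P = ∑ⱼ Pⱼ(x) yʲ ∈ R[x][y]`: the largest degree in `x` of a coefficient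
`Pⱼ`.  (The outer variable is `y`; the degree `deg_y P` is `P.natDegree`.) -/
noncomputable def polyHeight {R : Type*} [Semiring R] (P : Polynomial (Polynomial R)) : ℕ :=
  P.support.sup fun j => (P.coeff j).natDegree

/-- The value `P(x, F) = ∑ⱼ Pⱼ(x) F(x)ʲ` in `R⟦x⟧`. -/
noncomputable def evalAtSeries {R : Type*} [CommRing R] (P : Polynomial (Polynomial R))
    (F : PowerSeries R) : PowerSeries R :=
  P.eval₂ Polynomial.coeToPowerSeries.ringHom F

/-- `F` is the Furstenberg series associated with `P ∈ R[x][y]`: `P(0, 0) = 0`,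
`(∂P/∂y)(0, 0) ≠ 0`, `F(0) = 0` and `P(x, F) = 0`. -/
structure IsFurstenbergSeries {R : Type*} [CommRing R] (P : Polynomial (Polynomial R))
    (F : PowerSeries R) : Prop where
  eval_zero : Polynomial.evalEval 0 0 P = 0
  eval_derivative_ne_zero : Polynomial.evalEval 0 0 (Polynomial.derivative P) ≠ 0
  constantCoeff_eq_zero : PowerSeries.constantCoeff F = 0
  root : evalAtSeries P F = 0

/-- `lcm(σ)`, the least common multiple of the parts of an integer partition `σ`. -/
def partitionLcm {n : ℕ} (σ : n.Partition) : ℕ := σ.parts.lcm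

/-- `𝓛(l, m, n)`: the maximum of `lcm(lcm(σ₁), lcm(σ₂), lcm(σ₃))` over all `1 ≤ i ≤ l`,
`1 ≤ j ≤ m`, `1 ≤ k ≤ n` and all partitions `σ₁` of `i`, `σ₂` of `j`, `σ₃` of `k`. -/
def maxLcm (l m n : ℕ) : ℕ :=
  (Finset.Icc 1 l).sup fun i => (Finset.Icc 1 m).sup fun j => (Finset.Icc 1 n).sup fun k =>
    (Finset.univ : Finset i.Partition).sup fun σ₁ =>
      (Finset.univ : Finset j.Partition).sup fun σ₂ =>
        (Finset.univ : Finset k.Partition).sup fun σ₃ =>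
          Nat.lcm (Nat.lcm (partitionLcm σ₁) (partitionLcm σ₂)) (partitionLcm σ₃)

/-- The `q`-kernel `{ (a(qᵉ n + r))ₙ : e ≥ 0, 0 ≤ r ≤ qᵉ - 1 }` of a sequence. -/
def qKernel {β : Type*} (q : ℕ) (a : ℕ → β) : Set (ℕ → β) :=
  {b | ∃ e r : ℕ, r < q ^ e ∧ b = fun n => a (q ^ e * n + r)}

/-- A deterministic automaton with output: input alphabet `{0, …, q - 1}`, output alphabet `β`,
set of states `σ`. -/
structure DFAO (q : ℕ) (β : Type*) (σ : Type*) where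
  start : σ
  step : σ → Fin q → σ
  out : σ → β

namespace DFAO

/-- The output of the automaton when it is fed the word `w`, first letter first. -/
def output {q : ℕ} {β σ : Type*} (M : DFAO q β σ) (w : List (Fin q)) : β :=
  M.out (w.foldl M.step M.start)

/-- `M` generates `a`: fed the standard base-`q` representation of `n`, least significant digit
first, it outputs `a n`.  (`Nat.digits` lists the digits in this order, and the standard
representation of `0` is the empty word.) -/
def Generates {q : ℕ} {β σ : Type*} (M : DFAO q β σ) (a : ℕ → β) : Prop :=
  ∀ (n : ℕ) (w : List (Fin q)), w.map (fun c => (c : ℕ)) = q.digits n → M.output w = a n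

/-- `M` is not affected by leading zeros.  As words start with the least significant digit, the
leading zeros stand at the end of the word. -/
def IgnoresLeadingZeros {q : ℕ} {β σ : Type*} (M : DFAO q β σ) : Prop :=
  ∀ (w : List (Fin q)) (z : Fin q) (k : ℕ), (z : ℕ) = 0 →
    M.output (w ++ List.replicate k z) = M.output w

/-- `M` is a minimal automaton for `a`: among the finite automata that generate `a` and are not
affected by leading zeros it has the least number of states. -/
def IsMinimalFor {q : ℕ} {β σ : Type*} [Fintype σ] (M : DFAO q β σ) (a : ℕ → β) : Prop :=
  M.Generates a ∧ M.IgnoresLeadingZeros ∧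
    ∀ (τ : Type) [Fintype τ] (N : DFAO q β τ), N.Generates a → N.IgnoresLeadingZeros →
      Fintype.card σ ≤ Fintype.card τ

end DFAO

/-! Since F is a simple root of P, F = S₀(F) / P_y(F) with S₀ = y P_y, which is the residue of S₀ /
P at y = F. Sections of such residues are again such residues: passing to the indices qn + r
replaces the numerator S by `stateStep q r P S`, a Cartier operator in both variables applied to S
P^(q-1) (`residue_cartierTransform`). Hence the kernel is no larger than any set of numerators that
contains S₀ and is stable under these maps.

Numerators of bidegree at most (h-1, d-1) form a stable set of size q^(hd), and a step with r ≠ 0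
leads from bidegree (h, d) into it. What remains is the orbit of S₀ under r = 0. After one step it
lies in bidegree (h, d-1), and its coefficients of x⁰, x^h and y^(d-1) evolve on their own, by
univariate Cartier transforms attached to the corresponding border coefficients p of P (with an
extra factor x for P_d). If e > 0 is a multiple of the degrees of all irreducible factors of p, then
p divides (X^(q^e) - X)^(q^k) as soon as deg p ≤ q^k, and the transform has period e after k steps
(`iterate_cartierTransform_periodic`). The factor degrees fit into partitions of h, d and d, so the
borders share a period L ≤ 𝓛(h, d, d). Past the transient, n mod L and the (h-1)(d-1) interior
coefficients determine the orbit element.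

Finally, the kernel itself carries a minimal automaton, by a Myhill–Nerode argument. -/

/-! ### Cartier operators and residues at a simple root -/

section CartierOperators

variable {R : Type*} [CommRing R] {q : ℕ}

/-- An additive map `φ` is Cartier linear if `φ (a ^ q * s) = a * φ s`. -/
def IsCartierLinear (q : ℕ) (φ : R →+ R) : Prop :=
  ∀ a s : R, φ (a ^ q * s) = a * φ s

theorem sum_monomial_map_coeff (q r : ℕ) [NeZero q] (φ : R →+ R) (S : Polynomial R) (i : ℕ) :
    (∑ j ∈ Finset.range (S.natDegree + 1),
      Polynomial.monomial j (φ (S.coeff (q * j + r)))).coeff i = φ (S.coeff (q * i + r)) := by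
  simp only [Polynomial.finsetSum_coeff, Polynomial.coeff_monomial]
  rw [Finset.sum_ite_eq']
  split_ifs with h
  · rfl
  · rw [Polynomial.coeff_eq_zero_of_natDegree_lt, map_zero]
    have : i ≤ q * i := Nat.le_mul_of_pos_left _ (NeZero.pos q)
    simp at h
    omega

/-- The additive map on polynomials keeping only the coefficients whose index is `r` modulo `q`,
`∑ sₙ Yⁿ ↦ ∑ φ(s_{qj + r}) Yʲ`. -/
noncomputable def polyCartier (q r : ℕ) [NeZero q] (φ : R →+ R) :
    Polynomial R →+ Polynomial R where
  toFun S := ∑ j ∈ Finset.range (S.natDegree + 1), Polynomial.monomial j (φ (S.coeff (q * j + r)))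
  map_zero' := by simp
  map_add' S T := by
    ext i
    rw [Polynomial.coeff_add]
    simp only [sum_monomial_map_coeff]
    rw [Polynomial.coeff_add, map_add]

theorem polyCartier_coeff (q r : ℕ) [NeZero q] (φ : R →+ R) (S : Polynomial R) (i : ℕ) :
    (polyCartier q r φ S).coeff i = φ (S.coeff (q * i + r)) :=
  sum_monomial_map_coeff q r φ S i

theorem mul_le_mul_add_iff {q r : ℕ} (hr : r < q) (m i : ℕ) : m * q ≤ q * i + r ↔ m ≤ i := by
  constructor
  · intro h
    by_contra hlt
    push Not at hlt
    have : q * (i + 1) ≤ q * m := Nat.mul_le_mul_left q hlt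
    rw [mul_add, mul_one, mul_comm q m] at this
    omega
  · intro h
    have : q * m ≤ q * i := Nat.mul_le_mul_left q h
    rw [mul_comm q m] at this
    omega

/-- The `q`-th power map of `R` is additive. -/
def PowAdditive (q : ℕ) (R : Type*) [CommRing R] : Prop :=
  ∀ a b : R, (a + b) ^ q = a ^ q + b ^ q

theorem powAdditive_of_algebra (K R : Type*) [Field K] [Fintype K] [CommRing R] [Algebra K R] :
    PowAdditive (Fintype.card K) R := fun a b => by
  simpa using map_add (FiniteField.frobeniusAlgHom K R) a b

theorem PowAdditive.sub {R : Type*} [CommRing R] (h : PowAdditive q R) (a b : R) :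
    (a - b) ^ q = a ^ q - b ^ q := by
  rw [eq_sub_iff_add_eq, ← h, sub_add_cancel]

theorem PowAdditive.pow {R : Type*} [CommRing R] (h : PowAdditive q R) (n : ℕ) :
    PowAdditive (q ^ n) R := by
  induction n with
  | zero => intro a b; simp
  | succ n ih => intro a b; rw [pow_succ, pow_mul, pow_mul, pow_mul, ih, h]

/-- Additivity of the q-th power reduces the claim to a monomial c Yⁿ, whose q-th power shifts
indices by nq and so preserves classes modulo q. -/
theorem IsCartierLinear.polyCartier [NeZero q] (hR : PowAdditive q (Polynomial R)) {φ : R →+ R}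
    (hφ : IsCartierLinear q φ) {r : ℕ} (hr : r < q) : IsCartierLinear q (polyCartier q r φ) := by
  intro a s
  induction a using Polynomial.induction_on' with
  | add a b ha hb => rw [hR, add_mul, map_add, ha, hb, add_mul]
  | monomial n c =>
    ext i
    rw [polyCartier_coeff, Polynomial.monomial_pow, ← Polynomial.C_mul_X_pow_eq_monomial,
      ← Polynomial.C_mul_X_pow_eq_monomial, mul_assoc, mul_assoc, Polynomial.coeff_C_mul,
      Polynomial.coeff_C_mul, Polynomial.coeff_X_pow_mul', Polynomial.coeff_X_pow_mul']
    have h1 := mul_le_mul_add_iff hr n i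
    by_cases h : n ≤ i
    · rw [if_pos h, if_pos (h1.2 h), hφ, polyCartier_coeff]
      congr 3
      obtain ⟨k, rfl⟩ := Nat.exists_eq_add_of_le h
      rw [Nat.add_sub_cancel_left, mul_add, mul_comm n q]
      omega
    · rw [if_neg h, if_neg (fun h' => h (h1.1 h')), mul_zero, mul_zero, map_zero]

/-- The operator `S ↦ 𝒞(S P^{q-1})`, which describes the action of the Cartier operator on the
numerators of the fractions `S / P`. -/
noncomputable def cartierTransform (q : ℕ) [NeZero q] (φ : R →+ R) (P S : Polynomial R) :
    Polynomial R :=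
  polyCartier q (q - 1) φ (S * P ^ (q - 1))

/-- Taking residues commutes with Cartier operators: if `F` is a simple root of `P`, then `φ` maps
the residue `S(F) / P'(F)` of `S / P` at `F` to the residue of the Cartier transform. -/
theorem residue_cartierTransform [NeZero q] (hR : PowAdditive q (Polynomial R)) {φ : R →+ R}
    (hφ : IsCartierLinear q φ) (hq : 1 < q) (P S : Polynomial R) (F : R) (hF : P.eval F = 0)
    (c : R) (hc : P.derivative.eval F * c = 1) :
    φ (S.eval F * c) = (cartierTransform q φ P S).eval F * c := by
  have hlin := hφ.polyCartier hR (r := q - 1) (by omega)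
  -- Write P = (Y - F) U, so that P'(F) = U(F), and expand S U^(q-1) around F as (Y - F) G + g. The
  -- G part of S P^(q-1) carries (Y - F)^q, which leaves the operator as Y - F and vanishes at F.
  obtain ⟨U, hU⟩ := Polynomial.dvd_iff_isRoot.2 hF
  have hUF : P.derivative.eval F = U.eval F := by
    rw [hU]; simp
  rw [hUF] at hc
  set g := (S * U ^ (q - 1)).eval F with hg
  obtain ⟨G, hG⟩ := Polynomial.X_sub_C_dvd_sub_C_eval (a := F) (p := S * U ^ (q - 1))
  have hsplit : S * P ^ (q - 1) = (Polynomial.X - Polynomial.C F) ^ q * G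
      + Polynomial.C g * (Polynomial.X - Polynomial.C F) ^ (q - 1) := by
    have h1 : S * U ^ (q - 1) = (Polynomial.X - Polynomial.C F) * G + Polynomial.C g := by
      rw [← hG]; ring
    have h2 : (Polynomial.X - Polynomial.C F) ^ q
        = (Polynomial.X - Polynomial.C F) ^ (q - 1) * (Polynomial.X - Polynomial.C F) := by
      rw [← pow_succ, Nat.sub_add_cancel (by omega)]
    calc S * P ^ (q - 1) = (S * U ^ (q - 1)) * (Polynomial.X - Polynomial.C F) ^ (q - 1) := by
          rw [hU, mul_pow]; ring
      _ = _ := by rw [h1, h2]; ring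
  -- A multiple of a monic polynomial of degree q - 1: the only index congruent to q - 1 that can
  -- contribute is the leading one.
  have hconst : polyCartier q (q - 1) φ
      (Polynomial.C g * (Polynomial.X - Polynomial.C F) ^ (q - 1)) = Polynomial.C (φ g) := by
    have hmon : ((Polynomial.X - Polynomial.C F) ^ (q - 1)).Monic :=
      (Polynomial.monic_X_sub_C F).pow _
    ext i
    rw [polyCartier_coeff, Polynomial.coeff_C_mul, Polynomial.coeff_C]
    nontriviality R
    have hdeg : ((Polynomial.X - Polynomial.C F) ^ (q - 1)).natDegree = q - 1 := by
      rw [(Polynomial.monic_X_sub_C F).natDegree_pow, Polynomial.natDegree_X_sub_C, mul_one]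
    split_ifs with hi
    · subst hi
      have := hmon.coeff_natDegree
      rw [hdeg] at this
      rw [mul_zero, zero_add, this, mul_one]
    · rw [Polynomial.coeff_eq_zero_of_natDegree_lt, mul_zero, map_zero]
      rw [hdeg]
      have : 0 < q * i := Nat.mul_pos (by omega) (Nat.pos_of_ne_zero hi)
      omega
  rw [cartierTransform, hsplit, map_add, hlin, hconst]
  have hgc : φ g = U.eval F * φ (S.eval F * c) := by
    rw [← hφ]
    congr 1
    rw [hg, Polynomial.eval_mul, Polynomial.eval_pow]
    calc _ = S.eval F * U.eval F ^ (q - 1) * (U.eval F * c) := by rw [hc, mul_one]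
      _ = U.eval F ^ (q - 1 + 1) * (S.eval F * c) := by rw [pow_succ]; ring
      _ = _ := by rw [Nat.sub_add_cancel (by omega)]
  simp only [Polynomial.eval_add, Polynomial.eval_mul, Polynomial.eval_sub, Polynomial.eval_X,
    Polynomial.eval_C, sub_self, zero_mul, zero_add]
  rw [hgc, mul_right_comm, hc, one_mul]

end CartierOperators

/-! ### Sections of power series -/

section PowerSeriesSections

variable {K : Type*} [Field K] {q : ℕ}

/-- The section `∑ aₙ xⁿ ↦ ∑ a_{qn + r} xⁿ` of power series. -/
noncomputable def seriesSection (q r : ℕ) : PowerSeries K →+ PowerSeries K where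
  toFun s := PowerSeries.mk fun n => PowerSeries.coeff (q * n + r) s
  map_zero' := by ext; simp
  map_add' s t := by ext; simp

theorem seriesSection_coeff (r : ℕ) (s : PowerSeries K) (n : ℕ) :
    PowerSeries.coeff n (seriesSection q r s) = PowerSeries.coeff (q * n + r) s := by
  simp [seriesSection]

theorem isCartierLinear_id (q : ℕ) (hK : ∀ a : K, a ^ q = a) :
    IsCartierLinear q (AddMonoidHom.id K) := fun a s => by simp [hK]

theorem seriesSection_X_pow_mul {r : ℕ} (hr : r < q) (m : ℕ) (s : PowerSeries K) :
    seriesSection q r (PowerSeries.X ^ (m * q) * s) = PowerSeries.X ^ m * seriesSection q r s := by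
  have h1 := mul_le_mul_add_iff hr m
  ext i
  rw [seriesSection_coeff, PowerSeries.coeff_X_pow_mul', PowerSeries.coeff_X_pow_mul']
  by_cases h : m ≤ i
  · rw [if_pos h, if_pos ((h1 i).2 h), seriesSection_coeff]
    congr 2
    obtain ⟨k, rfl⟩ := Nat.exists_eq_add_of_le h
    rw [Nat.add_sub_cancel_left, mul_add, mul_comm m q]
    omega
  · rw [if_neg h, if_neg (fun h' => h ((h1 i).1 h'))]

theorem isCartierLinear_seriesSection (hR : PowAdditive q (PowerSeries K))
    (hK : ∀ a : K, a ^ q = a) {r : ℕ} (hr : r < q) :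
    IsCartierLinear q (seriesSection q r : PowerSeries K →+ PowerSeries K) := by
  have hpoly : ∀ (a : Polynomial K) (s : PowerSeries K),
      seriesSection q r ((a : PowerSeries K) ^ q * s) = a * seriesSection q r s := by
    intro a s
    induction a using Polynomial.induction_on' with
    | add a b ha hb => rw [Polynomial.coe_add, hR, add_mul, map_add, ha, hb, add_mul]
    | monomial n c =>
      have hmon : ((Polynomial.monomial n c : Polynomial K) : PowerSeries K)
          = PowerSeries.C c * PowerSeries.X ^ n := by
        rw [← Polynomial.C_mul_X_pow_eq_monomial]; simp
      have hC : ∀ t : PowerSeries K, seriesSection q r (PowerSeries.C c * t)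
          = PowerSeries.C c * seriesSection q r t := by
        intro t; ext i; simp [seriesSection_coeff]
      rw [hmon, mul_pow, ← map_pow, hK, ← pow_mul, mul_assoc, hC, seriesSection_X_pow_mul hr,
        mul_assoc]
  intro a s
  ext n
  -- The n-th coefficient sees only the truncation of a: the q-th power of the tail X^(n+1) b comes
  -- out of the section as a multiple of X^(n+1).
  obtain ⟨b, hb⟩ : ∃ b : PowerSeries K,
      a = ((PowerSeries.trunc (n + 1) a : Polynomial K) : PowerSeries K)
        + PowerSeries.X ^ (n + 1) * b := by
    have : PowerSeries.X ^ (n + 1) ∣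
        a - ((PowerSeries.trunc (n + 1) a : Polynomial K) : PowerSeries K) := by
      rw [PowerSeries.X_pow_dvd_iff]
      intro m hm
      simp [PowerSeries.coeff_trunc, hm]
    obtain ⟨b, hb⟩ := this
    exact ⟨b, by rw [← hb]; ring⟩
  have hX : ∀ t : PowerSeries K, PowerSeries.coeff n (PowerSeries.X ^ (n + 1) * t) = 0 := by
    intro t; rw [PowerSeries.coeff_X_pow_mul', if_neg (by omega)]
  rw [hb, hR, add_mul, map_add, hpoly, mul_pow, ← pow_mul, mul_assoc, seriesSection_X_pow_mul hr,
    add_mul, map_add, map_add, hX, mul_assoc, hX]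

theorem coe_polyCartier [NeZero q] (r : ℕ) (s : Polynomial K) :
    ((polyCartier q r (AddMonoidHom.id K) s : Polynomial K) : PowerSeries K)
      = seriesSection q r (s : PowerSeries K) := by
  ext n
  simp [seriesSection_coeff, polyCartier_coeff]

end PowerSeriesSections

/-! ### Eventual periodicity of univariate Cartier transforms -/

section UnivariatePeriodicity

variable {K : Type*} [Field K] {q : ℕ} [NeZero q]

/-- The factors a and a^(q-1) combine into a^q. This allows p to be replaced by a multiple of it, at
the cost of multiplying the argument. -/
theorem cartierTransform_mul_left {φ : K →+ K} (hlin : IsCartierLinear q (polyCartier q (q - 1) φ))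
    (a b u : Polynomial K) :
    cartierTransform q φ (a * b) (a * u) = a * cartierTransform q φ b u := by
  rw [cartierTransform, cartierTransform, ← hlin]
  congr 1
  obtain ⟨m, hm⟩ : ∃ m, q = m + 1 := ⟨q - 1, (Nat.sub_add_cancel (NeZero.pos q)).symm⟩
  subst hm
  simp only [Nat.add_sub_cancel]
  ring

theorem iterate_cartierTransform_mul_left {φ : K →+ K}
    (hlin : IsCartierLinear q (polyCartier q (q - 1) φ)) (a b u : Polynomial K) (n : ℕ) :
    (cartierTransform q φ (a * b))^[n] (a * u) = a * (cartierTransform q φ b)^[n] u := by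
  induction n generalizing u with
  | zero => rfl
  | succ n ih =>
    rw [Function.iterate_succ_apply, Function.iterate_succ_apply, cartierTransform_mul_left hlin, ih]

theorem cartierTransform_pow {φ : K →+ K} (hlin : IsCartierLinear q (polyCartier q (q - 1) φ))
    (b v : Polynomial K) :
    cartierTransform q φ (b ^ q) v = b ^ (q - 1) * polyCartier q (q - 1) φ v := by
  rw [cartierTransform, ← hlin]
  congr 1
  ring

theorem iterate_cartierTransform_pow {φ : K →+ K}
    (hlin : IsCartierLinear q (polyCartier q (q - 1) φ)) (b v : Polynomial K) (k : ℕ) :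
    (cartierTransform q φ (b ^ q ^ k))^[k] v
      = b ^ (q ^ k - 1) * (polyCartier q (q - 1) φ)^[k] v := by
  induction k generalizing v with
  | zero => simp
  | succ k ih =>
    have h0 : 1 ≤ q ^ k := Nat.one_le_pow _ _ (NeZero.pos q)
    have h1 : b ^ q ^ (k + 1) = (b ^ q ^ k) ^ (q - 1) * b ^ q ^ k := by
      rw [← pow_succ, Nat.sub_add_cancel (NeZero.pos q), ← pow_mul, ← pow_succ]
    have h2 : b ^ (q ^ (k + 1) - 1) = (b ^ q ^ k) ^ (q - 1) * b ^ (q ^ k - 1) := by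
      rw [← pow_mul, ← pow_add]
      congr 1
      obtain ⟨m, hm⟩ : ∃ m, q = m + 1 := ⟨q - 1, (Nat.sub_add_cancel (NeZero.pos q)).symm⟩
      rw [pow_succ]
      have : q ^ k * q = q ^ k * (q - 1) + q ^ k := by
        rw [hm, Nat.add_sub_cancel]; ring
      omega
    rw [Function.iterate_succ_apply, Function.iterate_succ_apply, pow_succ, pow_mul,
      cartierTransform_pow hlin, ← pow_mul, ← pow_succ, h1, iterate_cartierTransform_mul_left hlin,
      ih, h2, mul_assoc]

/-- The first k steps are pure Cartier steps up to the factor b^(q^k - 1). As b^(q^k) is that factor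
times b, the later steps are transforms by b alone. -/
theorem iterate_cartierTransform_pow_add {φ : K →+ K}
    (hlin : IsCartierLinear q (polyCartier q (q - 1) φ)) (b v : Polynomial K) (k n : ℕ) :
    (cartierTransform q φ (b ^ q ^ k))^[n + k] v
      = b ^ (q ^ k - 1) * (cartierTransform q φ b)^[n] ((polyCartier q (q - 1) φ)^[k] v) := by
  have h0 : 1 ≤ q ^ k := Nat.one_le_pow _ _ (NeZero.pos q)
  rw [Function.iterate_add_apply, iterate_cartierTransform_pow hlin]
  have h1 : b ^ q ^ k = b ^ (q ^ k - 1) * b := by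
    rw [← pow_succ, Nat.sub_add_cancel h0]
  rw [h1, iterate_cartierTransform_mul_left hlin]

/-- n steps in base q amount to one step in base q^n, because q^n (q - 1) + (q^n - 1) = q^(n+1) - 1,
both for exponents and for indices. -/
theorem iterate_cartierTransform_eq (hK : ∀ a : K, a ^ q = a) (hR : PowAdditive q (Polynomial K))
    (b w : Polynomial K) (n : ℕ) :
    (cartierTransform q (AddMonoidHom.id K) b)^[n] w
      = polyCartier (q ^ n) (q ^ n - 1) (AddMonoidHom.id K) (w * b ^ (q ^ n - 1)) := by
  induction n with
  | zero =>
    ext i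
    simp [polyCartier_coeff]
  | succ n ih =>
    have h0 : 1 ≤ q ^ n := Nat.one_le_pow _ _ (NeZero.pos q)
    have hq : q ^ n * q = q ^ n * (q - 1) + q ^ n := by
      rw [← mul_add_one, Nat.sub_add_cancel (Nat.one_le_iff_ne_zero.2 (NeZero.ne q))]
    have hKn : ∀ a : K, a ^ q ^ n = a := fun a => by
      clear ih h0 hq
      induction n with
      | zero => simp
      | succ n ih => rw [pow_succ, pow_mul, ih, hK]
    have hlin := (isCartierLinear_id (q ^ n) hKn).polyCartier (hR.pow n) (r := q ^ n - 1)
      (by omega)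
    rw [Function.iterate_succ_apply', ih, cartierTransform, mul_comm _ (b ^ (q - 1)), ← hlin]
    have hexp : (b ^ (q - 1)) ^ q ^ n * (w * b ^ (q ^ n - 1)) = w * b ^ (q ^ (n + 1) - 1) := by
      rw [mul_left_comm, ← pow_mul, ← pow_add]
      congr 2
      rw [pow_succ, hq, mul_comm (q - 1)]
      omega
    rw [hexp]
    ext i
    simp only [polyCartier_coeff, AddMonoidHom.id_apply]
    congr 1
    have h2 : q ^ n * (q * i + (q - 1)) = q ^ (n + 1) * i + q ^ n * (q - 1) := by ring
    rw [h2, pow_succ, hq]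
    omega

/-- If all coefficients from M on vanish, one step keeps index i only when q (i + 1) < M + 1. So M +
1, not M, is what each step divides by q. -/
theorem coeff_iterate_polyCartier_eq_zero (v : Polynomial K) (k M N : ℕ)
    (hv : ∀ i, M ≤ i → v.coeff i = 0) (hMN : M + 1 ≤ q ^ k * (N + 1)) (i : ℕ) (hi : N ≤ i) :
    ((polyCartier q (q - 1) (AddMonoidHom.id K))^[k] v).coeff i = 0 := by
  induction k generalizing v M with
  | zero => exact hv i (by simp at hMN; omega)
  | succ k ih =>
    have h0 : 1 ≤ q ^ k * (N + 1) := Nat.mul_pos (Nat.one_le_pow _ _ (NeZero.pos q)) (by omega)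
    rw [Function.iterate_succ_apply]
    refine ih _ (q ^ k * (N + 1) - 1) (fun j hj => ?_) (by omega)
    rw [polyCartier_coeff, AddMonoidHom.id_apply]
    apply hv
    have h1 : q * (q ^ k * (N + 1)) ≤ q * j + q :=
      (Nat.mul_le_mul_left q (by omega : _ ≤ j + 1)).trans_eq (mul_add_one _ _)
    have h2 : q ^ (k + 1) * (N + 1) = q * (q ^ k * (N + 1)) := by ring
    have := NeZero.pos q
    omega

/-- With Z = X^(Q-1), (Z - 1)^(Q-1) = (Z^Q - 1) / (Z - 1). -/
theorem pow_sub_one_eq_geom_sum {Q : ℕ} (hQ : PowAdditive Q (Polynomial K)) (hQ1 : 1 < Q) :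
    (Polynomial.X ^ Q - Polynomial.X : Polynomial K) ^ (Q - 1)
      = Polynomial.X ^ (Q - 1) * ∑ k ∈ Finset.range Q, Polynomial.X ^ ((Q - 1) * k) := by
  have hne : (Polynomial.X ^ (Q - 1) - 1 : Polynomial K) ≠ 0 :=
    (Polynomial.monic_X_pow_sub_C (1 : K) (by omega)).ne_zero
  have h1 : (Polynomial.X ^ (Q - 1) - 1 : Polynomial K) ^ (Q - 1)
      = ∑ k ∈ Finset.range Q, Polynomial.X ^ ((Q - 1) * k) := by
    apply mul_right_cancel₀ hne
    rw [← pow_succ, Nat.sub_add_cancel (by omega), hQ.sub, one_pow]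
    simp only [pow_mul]
    rw [geom_sum_mul]
  rw [← h1, ← mul_pow]
  congr 1
  rw [mul_sub, mul_one, ← pow_succ', Nat.sub_add_cancel (by omega)]

/-- By the geometric sum, the coefficient at Qj + Q - 1 is the sum of w_{Qj - (Q-1)k} over k < Q,
and only k = j gives an index in [0, Q), namely j. -/
theorem polyCartier_mul_pow_sub_one {Q : ℕ} [NeZero Q] (hQ : PowAdditive Q (Polynomial K))
    (hQ1 : 1 < Q) (w : Polynomial K) (hw : ∀ i, Q ≤ i → w.coeff i = 0) :
    polyCartier Q (Q - 1) (AddMonoidHom.id K)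
      (w * (Polynomial.X ^ Q - Polynomial.X) ^ (Q - 1)) = w := by
  rw [pow_sub_one_eq_geom_sum hQ hQ1]
  ext j
  rw [polyCartier_coeff, AddMonoidHom.id_apply, mul_left_comm, Polynomial.coeff_X_pow_mul,
    Finset.mul_sum, Polynomial.finsetSum_coeff]
  simp only [Polynomial.coeff_mul_X_pow']
  have key : ∀ k < Q, (Q - 1) * k ≤ Q * j → w.coeff (Q * j - (Q - 1) * k) ≠ 0 → k = j := by
    intro k hk hle hne
    have hlt : Q * j - (Q - 1) * k < Q := by
      by_contra h
      exact hne (hw _ (not_lt.1 h))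
    obtain ⟨m, rfl⟩ : ∃ m, Q = m + 1 := ⟨Q - 1, by omega⟩
    rw [Nat.add_sub_cancel] at hle hlt
    have hlt' : (m + 1) * j < m + 1 + m * k := by omega
    rcases lt_trichotomy k j with h | h | h
    · nlinarith
    · exact h
    · nlinarith
  by_cases hj : j < Q
  · rw [Finset.sum_eq_single j]
    · have h1 : (Q - 1) * j ≤ Q * j := Nat.mul_le_mul_right j (by omega)
      rw [if_pos h1]
      congr 1
      rw [Nat.sub_mul, one_mul]
      have : j ≤ Q * j := Nat.le_mul_of_pos_left _ (by omega)
      omega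
    · intro k hk hkj
      split_ifs with h
      · by_contra hne
        exact hkj (key k (Finset.mem_range.1 hk) h hne)
      · rfl
    · intro h
      exact absurd (Finset.mem_range.2 hj) h
  · rw [hw j (not_lt.1 hj)]
    refine Finset.sum_eq_zero fun k hk => ?_
    split_ifs with h
    · by_contra hne
      have := key k (Finset.mem_range.1 hk) h hne
      have := Finset.mem_range.1 hk
      omega
    · rfl

/-- With E = X^(q^e) - X and a p = E^(q^k), multiplying by a turns the transform by p into that by
E^(q^k). After k steps this is the transform by E acting on a polynomial of degree less than q^e,
where e further steps are the identity. The bound on deg u is what makes the degree small enough. -/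
theorem iterate_cartierTransform_periodic (hK : ∀ a : K, a ^ q = a)
    (hR : PowAdditive q (Polynomial K)) (hq : 1 < q) {p u : Polynomial K} {k e : ℕ} (he : e ≠ 0)
    (hp : p ∣ (Polynomial.X ^ q ^ e - Polynomial.X) ^ q ^ k)
    (hu : u.natDegree + 1 < p.natDegree + q ^ k) {n : ℕ} (hn : k ≤ n) :
    (cartierTransform q (AddMonoidHom.id K) p)^[n + e] u
      = (cartierTransform q (AddMonoidHom.id K) p)^[n] u := by
  have hlin := (isCartierLinear_id q hK).polyCartier hR (r := q - 1) (by omega)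
  have hQ1 : 1 < q ^ e := Nat.one_lt_pow he hq
  set E : Polynomial K := Polynomial.X ^ q ^ e - Polynomial.X with hE
  have hEmonic : E.Monic := Polynomial.monic_X_pow_sub (by
    rw [Polynomial.degree_X]; exact_mod_cast hQ1)
  have hEdeg : E.natDegree = q ^ e := by
    rw [hE, Polynomial.natDegree_sub_eq_left_of_natDegree_lt] <;> simp [hQ1]
  obtain ⟨a, ha⟩ := hp
  rw [mul_comm] at ha
  have hne : a * p ≠ 0 := ha ▸ (hEmonic.pow _).ne_zero
  have ha0 : a ≠ 0 := left_ne_zero_of_mul hne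
  have hp0 : p ≠ 0 := right_ne_zero_of_mul hne
  have hdeg : a.natDegree + p.natDegree = q ^ k * q ^ e := by
    rw [← Polynomial.natDegree_mul ha0 hp0, ← ha, hEmonic.natDegree_pow, hEdeg]
  have hw : ∀ i, q ^ e ≤ i →
      ((polyCartier q (q - 1) (AddMonoidHom.id K))^[k] (a * u)).coeff i = 0 := by
    refine coeff_iterate_polyCartier_eq_zero _ k (a.natDegree + u.natDegree + 1) _
      (fun i hi => ?_) ?_
    · apply Polynomial.coeff_eq_zero_of_natDegree_lt
      have := Polynomial.natDegree_mul_le (p := a) (q := u)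
      omega
    · rw [mul_add, mul_one]
      omega
  apply mul_left_cancel₀ ha0
  obtain ⟨m, rfl⟩ := Nat.exists_eq_add_of_le hn
  rw [← iterate_cartierTransform_mul_left hlin, ← iterate_cartierTransform_mul_left hlin, ← ha,
    show k + m + e = (m + e) + k by ring, add_comm k m, iterate_cartierTransform_pow_add hlin,
    iterate_cartierTransform_pow_add hlin, Function.iterate_add_apply,
    iterate_cartierTransform_eq hK hR _ _ e, polyCartier_mul_pow_sub_one (hR.pow e) hQ1 _ hw]

end UnivariatePeriodicity

/-! ### Degrees of irreducible factors and partitions -/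

section FactorDegrees

variable {K : Type*} [Field K]

/-- Counted with multiplicity, p has at most deg p irreducible factors, each of which divides E. -/
theorem dvd_pow_of_forall_irreducible_dvd {p E : Polynomial K} (hp : p ≠ 0) {N : ℕ}
    (hN : p.natDegree ≤ N) (h : ∀ π, Irreducible π → π ∣ p → π ∣ E) : p ∣ E ^ N := by
  induction N generalizing p with
  | zero =>
    rw [pow_zero]
    exact (Polynomial.isUnit_iff_degree_eq_zero.2
      (by rw [Polynomial.degree_eq_natDegree hp, Nat.le_zero.1 hN]; rfl)).dvd
  | succ N ih =>
    by_cases hu : IsUnit p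
    · exact hu.dvd
    · obtain ⟨π, hπ, g, rfl⟩ := WfDvdMonoid.exists_irreducible_factor hu hp
      have hg : g ≠ 0 := right_ne_zero_of_mul hp
      rw [pow_succ']
      refine mul_dvd_mul (h π hπ (dvd_mul_right _ _)) (ih hg ?_ fun ρ hρ hd =>
        h ρ hρ (hd.mul_left _))
      rw [Polynomial.natDegree_mul hπ.ne_zero hg] at hN
      have := hπ.natDegree_pos
      omega

/-- The degrees of the irreducible factors of a polynomial of degree at most `N` divide the least
common multiple of the parts of a partition of `N`. -/
theorem exists_partition_natDegree_dvd {p : Polynomial K} (hp : p ≠ 0) {N : ℕ}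
    (hN : p.natDegree ≤ N) :
    ∃ σ : N.Partition, ∀ π, Irreducible π → π ∣ p → π.natDegree ∣ partitionLcm σ := by
  induction N using Nat.strong_induction_on generalizing p with
  | _ N ih =>
    by_cases hu : IsUnit p
    -- Whatever is left of N may be partitioned arbitrarily, since extra parts only enlarge the lcm.
    · exact ⟨default, fun π hπ hd => absurd (isUnit_of_dvd_unit hd hu) hπ.not_isUnit⟩
    · obtain ⟨π, hπ, g, rfl⟩ := WfDvdMonoid.exists_irreducible_factor hu hp
      have hg : g ≠ 0 := right_ne_zero_of_mul hp
      rw [Polynomial.natDegree_mul hπ.ne_zero hg] at hN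
      have hpos := hπ.natDegree_pos
      obtain ⟨σ, hσ⟩ := ih (N - π.natDegree) (by omega) hg (by omega)
      refine ⟨⟨π.natDegree ::ₘ σ.parts, ?_, ?_⟩, ?_⟩
      · intro i hi
        rcases Multiset.mem_cons.1 hi with rfl | hi
        · exact hpos
        · exact σ.parts_pos hi
      · rw [Multiset.sum_cons, σ.parts_sum]; omega
      · intro ρ hρ hd
        simp only [partitionLcm, Multiset.lcm_cons]
        rcases hρ.prime.dvd_or_dvd hd with hd | hd
        · have : Associated ρ π := hρ.associated_of_dvd hπ hd
          rw [Polynomial.natDegree_eq_of_degree_eq (Polynomial.degree_eq_degree_of_associated this)]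
          exact dvd_lcm_left _ _
        · exact (hσ ρ hρ hd).trans (dvd_lcm_right _ _)

theorem partitionLcm_pos {n : ℕ} (σ : n.Partition) : 0 < partitionLcm σ := by
  rw [partitionLcm, Nat.pos_iff_ne_zero, Ne, Multiset.lcm_eq_zero_iff]
  intro h
  exact absurd (σ.parts_pos h) (lt_irrefl 0)

end FactorDegrees

/-! ### Bidegrees and the border coefficients of numerators -/

section BivariateStates

open Polynomial.Bivariate in
theorem coeff_coeff_swap {R : Type*} [CommSemiring R] (S : Polynomial (Polynomial R)) (i j : ℕ) :
    ((swap S).coeff i).coeff j = (S.coeff j).coeff i := by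
  induction S using Polynomial.induction_on' with
  | add S T hS hT => simp [hS, hT]
  | monomial n a =>
    induction a using Polynomial.induction_on' with
    | add a b ha hb =>
      rw [map_add, map_add, Polynomial.coeff_add, Polynomial.coeff_add, ha, hb,
        Polynomial.coeff_add, Polynomial.coeff_add]
    | monomial m c =>
      rw [swap_monomial_monomial]
      simp only [Polynomial.coeff_monomial]
      split_ifs with h1 h2 <;> simp [Polynomial.coeff_monomial, *]

open Polynomial.Bivariate

/-- `S ∈ R[x][y]` has degree at most `m` in `x` and at most `n` in `y`. -/
def BidegreeLE {R : Type*} [CommSemiring R] (m n : ℕ) (S : Polynomial (Polynomial R)) : Prop :=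
  (swap S).natDegree ≤ m ∧ S.natDegree ≤ n

section General

variable {R : Type*} [CommSemiring R]

theorem BidegreeLE.coeff_coeff {m n : ℕ} {S : Polynomial (Polynomial R)} (hS : BidegreeLE m n S)
    {i j : ℕ} (h : m < i ∨ n < j) : (S.coeff j).coeff i = 0 := by
  rcases h with h | h
  · rw [← coeff_coeff_swap, Polynomial.coeff_eq_zero_of_natDegree_lt (hS.1.trans_lt h),
      Polynomial.coeff_zero]
  · rw [Polynomial.coeff_eq_zero_of_natDegree_lt (hS.2.trans_lt h), Polynomial.coeff_zero]

theorem bidegreeLE_of_coeff {m n : ℕ} {S : Polynomial (Polynomial R)}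
    (h : ∀ i j, m < i ∨ n < j → (S.coeff j).coeff i = 0) : BidegreeLE m n S := by
  constructor
  · rw [Polynomial.natDegree_le_iff_coeff_eq_zero]
    intro i hi
    ext j
    rw [coeff_coeff_swap, h i j (Or.inl hi), Polynomial.coeff_zero]
  · rw [Polynomial.natDegree_le_iff_coeff_eq_zero]
    intro j hj
    ext i
    rw [h i j (Or.inr hj), Polynomial.coeff_zero]

theorem BidegreeLE.mul {m n m' n' : ℕ} {S T : Polynomial (Polynomial R)} (hS : BidegreeLE m n S)
    (hT : BidegreeLE m' n' T) : BidegreeLE (m + m') (n + n') (S * T) :=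
  ⟨by rw [map_mul]; exact Polynomial.natDegree_mul_le_of_le hS.1 hT.1,
    Polynomial.natDegree_mul_le_of_le hS.2 hT.2⟩

theorem BidegreeLE.pow {m n : ℕ} {S : Polynomial (Polynomial R)} (hS : BidegreeLE m n S)
    (k : ℕ) : BidegreeLE (k * m) (k * n) (S ^ k) :=
  ⟨by rw [map_pow]; exact Polynomial.natDegree_pow_le_of_le k hS.1,
    Polynomial.natDegree_pow_le_of_le k hS.2⟩

theorem BidegreeLE.mono {m n m' n' : ℕ} {S : Polynomial (Polynomial R)} (hS : BidegreeLE m n S)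
    (hm : m ≤ m') (hn : n ≤ n') : BidegreeLE m' n' S :=
  ⟨hS.1.trans hm, hS.2.trans hn⟩

theorem bidegreeLE_polyHeight (P : Polynomial (Polynomial R)) :
    BidegreeLE (polyHeight P) P.natDegree P := by
  refine bidegreeLE_of_coeff fun i j h => ?_
  rcases h with h | h
  · apply Polynomial.coeff_eq_zero_of_natDegree_lt
    by_cases hj : j ∈ P.support
    · exact (Finset.le_sup (f := fun j => (P.coeff j).natDegree) hj).trans_lt h
    · rw [Polynomial.notMem_support_iff.1 hj, Polynomial.natDegree_zero]
      exact (Nat.zero_le _).trans_lt h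
  · rw [Polynomial.coeff_eq_zero_of_natDegree_lt h, Polynomial.coeff_zero]

theorem coeff_swap_polyHeight_ne_zero {P : Polynomial (Polynomial R)} (hP : P ≠ 0) :
    (swap P).coeff (polyHeight P) ≠ 0 := by
  have hne : P.support.Nonempty := Polynomial.nonempty_support_iff.2 hP
  obtain ⟨j, hj, hjsup⟩ := Finset.exists_mem_eq_sup _ hne fun j => (P.coeff j).natDegree
  intro h
  have h1 : (P.coeff j).coeff (polyHeight P) = 0 := by
    rw [← coeff_coeff_swap, h, Polynomial.coeff_zero]
  have h2 : polyHeight P = (P.coeff j).natDegree := hjsup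
  rw [h2] at h1
  exact Polynomial.mem_support_iff.1 hj (Polynomial.leadingCoeff_eq_zero.1 h1)

end General

variable {K : Type*} [Field K]

/-- The operator on numerators `S ∈ K[x][y]` of fractions `S / P` induced by the section
`∑ aₙ xⁿ ↦ ∑ a_{qn + r} xⁿ` and the Cartier operator in `y`. -/
noncomputable def stateStep (q r : ℕ) [NeZero q] (P : Polynomial (Polynomial K)) :
    Polynomial (Polynomial K) → Polynomial (Polynomial K) :=
  cartierTransform q (polyCartier q r (AddMonoidHom.id K)) P

variable {q : ℕ} [NeZero q]

theorem stateStep_coeff_coeff (r : ℕ) (P S : Polynomial (Polynomial K)) (i j : ℕ) :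
    ((stateStep q r P S).coeff j).coeff i
      = ((S * P ^ (q - 1)).coeff (q * j + (q - 1))).coeff (q * i + r) := by
  rw [stateStep, cartierTransform, polyCartier_coeff, polyCartier_coeff, AddMonoidHom.id_apply]

theorem bidegreeLE_stateStep {r h d m n m' n' : ℕ} {P S : Polynomial (Polynomial K)}
    (hP : BidegreeLE h d P) (hS : BidegreeLE m n S) (hm : m + (q - 1) * h < q * (m' + 1) + r)
    (hn : n + (q - 1) * d < q * (n' + 1) + (q - 1)) : BidegreeLE m' n' (stateStep q r P S) := by
  refine bidegreeLE_of_coeff fun i j hij => ?_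
  rw [stateStep_coeff_coeff]
  refine (hS.mul (hP.pow (q - 1))).coeff_coeff ?_
  rcases hij with hi | hj
  · left
    have : q * (m' + 1) ≤ q * i := Nat.mul_le_mul_left q hi
    omega
  · right
    have : q * (n' + 1) ≤ q * j := Nat.mul_le_mul_left q hj
    omega

/-- Taking the coefficient of x⁰ is multiplicative, so this border evolves independently of the
rest. -/
theorem swap_stateStep_coeff_zero (P S : Polynomial (Polynomial K)) :
    (swap (stateStep q 0 P S)).coeff 0
      = cartierTransform q (AddMonoidHom.id K) ((swap P).coeff 0) ((swap S).coeff 0) := by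
  ext j
  rw [coeff_coeff_swap, stateStep_coeff_coeff, ← coeff_coeff_swap, cartierTransform,
    polyCartier_coeff, AddMonoidHom.id_apply, map_mul, map_pow, mul_zero, zero_add,
    Polynomial.mul_coeff_zero, Polynomial.coeff_zero_eq_eval_zero (swap P ^ (q - 1)),
    Polynomial.eval_pow, ← Polynomial.coeff_zero_eq_eval_zero]

/-- The index qh = h + (q - 1)h is the largest possible x-degree of S P^(q-1), so only top
coefficients enter. -/
theorem swap_stateStep_coeff_top {h d n : ℕ} {P S : Polynomial (Polynomial K)}
    (hP : BidegreeLE h d P) (hS : BidegreeLE h n S) :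
    (swap (stateStep q 0 P S)).coeff h
      = cartierTransform q (AddMonoidHom.id K) ((swap P).coeff h) ((swap S).coeff h) := by
  have hq : q * h + 0 = h + (q - 1) * h := by
    rw [add_zero, add_comm, ← Nat.succ_mul, Nat.succ_eq_add_one,
      Nat.sub_add_cancel (Nat.one_le_iff_ne_zero.2 (NeZero.ne q))]
  ext j
  rw [coeff_coeff_swap, stateStep_coeff_coeff, ← coeff_coeff_swap, cartierTransform,
    polyCartier_coeff, AddMonoidHom.id_apply, map_mul, map_pow, hq,
    Polynomial.coeff_mul_add_eq_of_natDegree_le hS.1 (Polynomial.natDegree_pow_le_of_le _ hP.1),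
    Polynomial.coeff_pow_of_natDegree_le hP.1]

/-- Again a top coefficient, now in y. In x the indices kept are qi rather than qi + q - 1; the
factor X, raised to the power q - 1, makes up the shift. -/
theorem stateStep_coeff_top {h d m : ℕ} {P S : Polynomial (Polynomial K)} (hd : 1 ≤ d)
    (hP : BidegreeLE h d P) (hS : BidegreeLE m (d - 1) S) :
    (stateStep q 0 P S).coeff (d - 1)
      = cartierTransform q (AddMonoidHom.id K) (Polynomial.X * P.coeff d) (S.coeff (d - 1)) := by
  have hq : q * (d - 1) + (q - 1) = (d - 1) + (q - 1) * d := by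
    obtain ⟨m, hm⟩ : ∃ m, q = m + 1 :=
      ⟨q - 1, (Nat.sub_add_cancel (Nat.one_le_iff_ne_zero.2 (NeZero.ne q))).symm⟩
    obtain ⟨n, rfl⟩ : ∃ n, d = n + 1 := ⟨d - 1, by omega⟩
    rw [hm]
    simp only [Nat.add_sub_cancel]
    ring
  ext i
  rw [stateStep_coeff_coeff, hq, Polynomial.coeff_mul_add_eq_of_natDegree_le hS.2
    (Polynomial.natDegree_pow_le_of_le _ hP.2), Polynomial.coeff_pow_of_natDegree_le hP.2,
    cartierTransform, polyCartier_coeff, AddMonoidHom.id_apply, mul_pow, mul_left_comm,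
    Polynomial.coeff_X_pow_mul, add_zero]

end BivariateStates

/-! ### Kernel elements as residues of numerators -/

section Residues

variable {K : Type*} [Field K]

theorem evalAtSeries_eq_eval_map {R : Type*} [CommRing R] (S : Polynomial (Polynomial R))
    (F : PowerSeries R) :
    evalAtSeries S F = (S.map Polynomial.coeToPowerSeries.ringHom).eval F := by
  rw [evalAtSeries, Polynomial.eval_map]

theorem constantCoeff_evalAtSeries {R : Type*} [CommRing R] (S : Polynomial (Polynomial R))
    {F : PowerSeries R} (hF : PowerSeries.constantCoeff F = 0) :
    PowerSeries.constantCoeff (evalAtSeries S F) = Polynomial.evalEval 0 0 S := by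
  rw [evalAtSeries, Polynomial.hom_eval₂, hF, ← Polynomial.eval₂_evalRingHom]
  congr 1
  ext <;> simp

theorem exists_inverse_evalAtSeries_derivative {P : Polynomial (Polynomial K)} {F : PowerSeries K}
    (hF : IsFurstenbergSeries P F) :
    ∃ c : PowerSeries K, evalAtSeries (Polynomial.derivative P) F * c = 1 := by
  refine ⟨(evalAtSeries (Polynomial.derivative P) F)⁻¹, PowerSeries.mul_inv_cancel _ ?_⟩
  rw [constantCoeff_evalAtSeries _ hF.constantCoeff_eq_zero]
  exact hF.eval_derivative_ne_zero

variable {q : ℕ} [NeZero q]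

theorem map_stateStep (r : ℕ) (P S : Polynomial (Polynomial K)) :
    (stateStep q r P S).map Polynomial.coeToPowerSeries.ringHom
      = cartierTransform q (seriesSection q r) (P.map Polynomial.coeToPowerSeries.ringHom)
        (S.map Polynomial.coeToPowerSeries.ringHom) := by
  ext1 j
  rw [stateStep, cartierTransform, cartierTransform, Polynomial.coeff_map, polyCartier_coeff,
    polyCartier_coeff, ← Polynomial.map_pow, ← Polynomial.map_mul, Polynomial.coeff_map]
  exact coe_polyCartier r _

theorem seriesSection_residue (hq : 1 < q) (hK : ∀ a : K, a ^ q = a)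
    (hR : PowAdditive q (PowerSeries K)) (hR' : PowAdditive q (Polynomial (PowerSeries K)))
    {P : Polynomial (Polynomial K)} {F c : PowerSeries K} (hF : IsFurstenbergSeries P F)
    (hc : evalAtSeries (Polynomial.derivative P) F * c = 1) {r : ℕ} (hr : r < q)
    (S : Polynomial (Polynomial K)) :
    seriesSection q r (evalAtSeries S F * c) = evalAtSeries (stateStep q r P S) F * c := by
  simp only [evalAtSeries_eq_eval_map, map_stateStep]
  apply residue_cartierTransform hR' (isCartierLinear_seriesSection hR hK hr) hq
  · rw [← evalAtSeries_eq_eval_map, hF.root]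
  · rw [Polynomial.derivative_map, ← evalAtSeries_eq_eval_map, hc]

theorem exists_state_of_section {P : Polynomial (Polynomial K)} {F c : PowerSeries K}
    {X : Set (Polynomial (Polynomial K))}
    (hX : ∀ S ∈ X, ∀ r < q, stateStep q r P S ∈ X)
    (hres : ∀ r < q, ∀ S, seriesSection q r (evalAtSeries S F * c)
      = evalAtSeries (stateStep q r P S) F * c) (e : ℕ) :
    ∀ S ∈ X, ∀ r < q ^ e, ∃ S' ∈ X, ∀ n,
      PowerSeries.coeff (q ^ e * n + r) (evalAtSeries S F * c)
        = PowerSeries.coeff n (evalAtSeries S' F * c) := by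
  induction e with
  | zero =>
    intro S hS r hr
    obtain rfl : r = 0 := by simpa using hr
    exact ⟨S, hS, fun n => by simp⟩
  | succ e ih =>
    intro S hS r hr
    have h1 : r % q < q := Nat.mod_lt _ (NeZero.pos q)
    have h2 : r / q < q ^ e := by
      rw [Nat.div_lt_iff_lt_mul (NeZero.pos q), ← pow_succ]; exact hr
    obtain ⟨S', hS', hn⟩ := ih _ (hX S hS _ h1) (r / q) h2
    refine ⟨S', hS', fun n => ?_⟩
    rw [← hn, ← hres _ h1, seriesSection_coeff]
    congr 2
    -- The least significant digit r % q is removed first, and r / q is left to the induction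
    -- hypothesis.
    conv_lhs => rw [← Nat.div_add_mod r q]
    ring

theorem qKernel_subset_image {P : Polynomial (Polynomial K)} {F c : PowerSeries K}
    {X : Set (Polynomial (Polynomial K))}
    (hX : ∀ S ∈ X, ∀ r < q, stateStep q r P S ∈ X)
    (hres : ∀ r < q, ∀ S, seriesSection q r (evalAtSeries S F * c)
      = evalAtSeries (stateStep q r P S) F * c)
    {S₀ : Polynomial (Polynomial K)} (hS₀ : S₀ ∈ X) (hF : evalAtSeries S₀ F * c = F) :
    qKernel q (fun n => PowerSeries.coeff n F)
      ⊆ (fun S n => PowerSeries.coeff n (evalAtSeries S F * c)) '' X := by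
  rintro b ⟨e, r, hr, rfl⟩
  obtain ⟨S', hS', hn⟩ := exists_state_of_section hX hres e S₀ hS₀ r hr
  refine ⟨S', hS', ?_⟩
  ext n
  exact (hn n).symm.trans (by rw [hF])

end Residues

/-! ### Minimal automata and the kernel -/

section MinimalAutomata

variable {β : Type*} {q : ℕ}

/-- The value of a word of base-`q` digits, least significant digit first. -/
def wordValue (w : List (Fin q)) : ℕ := Nat.ofDigits q (w.map Fin.val)

/-- In `Generates` the coercion to ℕ falls on the whole word, as a monadic bind; here it is moved to
the letters. -/
theorem DFAO.generates_iff {σ : Type*} {M : DFAO q β σ} {a : ℕ → β} :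
    M.Generates a ↔ ∀ (n : ℕ) (w : List (Fin q)), w.map Fin.val = q.digits n →
      M.output w = a n := by
  have h : ∀ w : List (Fin q), List.map (fun c : ℕ => c) (w >>= fun c => pure (c : ℕ))
      = w.map Fin.val := fun w => by
    induction w with
    | nil => rfl
    | cons c w ih => simpa using ih
  exact forall_congr' fun n => forall_congr' fun w => by rw [h]

theorem map_val_lt (w : List (Fin q)) : ∀ x ∈ w.map Fin.val, x < q := by
  intro x hx
  obtain ⟨c, -, rfl⟩ := List.mem_map.1 hx
  exact c.2

theorem wordValue_append (v w : List (Fin q)) :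
    wordValue (v ++ w) = wordValue v + q ^ v.length * wordValue w := by
  simp [wordValue, Nat.ofDigits_append]

theorem wordValue_singleton (c : Fin q) : wordValue [c] = c := by
  simp [wordValue]

theorem exists_word (hq : 1 < q) (e r : ℕ) (hr : r < q ^ e) :
    ∃ w : List (Fin q), w.length = e ∧ wordValue w = r := by
  induction e generalizing r with
  | zero => exact ⟨[], rfl, by simp at hr; simp [wordValue, hr]⟩
  | succ e ih =>
    have h2 : r / q < q ^ e := by
      rw [Nat.div_lt_iff_lt_mul (by omega), ← pow_succ]; exact hr
    obtain ⟨w, hw, hv⟩ := ih _ h2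
    refine ⟨⟨r % q, Nat.mod_lt _ (by omega)⟩ :: w, by simp [hw], ?_⟩
    have := wordValue_append [(⟨r % q, Nat.mod_lt _ (by omega)⟩ : Fin q)] w
    rw [List.singleton_append] at this
    rw [this, wordValue_singleton, hv, List.length_singleton, pow_one]
    exact Nat.mod_add_div r q

/-- An automaton that generates `a` and ignores leading zeros outputs `a n` on every representation
of `n`, with or without leading zeros. -/
theorem DFAO.output_eq_of_generates {σ : Type*} {M : DFAO q β σ} {a : ℕ → β} (hq : 1 < q)
    (hM : M.Generates a) (hz : M.IgnoresLeadingZeros) (w : List (Fin q)) :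
    M.output w = a (wordValue w) := by
  induction w using List.reverseRecOn with
  | nil => exact DFAO.generates_iff.1 hM 0 [] (by simp)
  | append_singleton w c ih =>
    by_cases hc : (c : ℕ) = 0
    · have := hz w c 1 hc
      rw [List.replicate_one] at this
      rw [this, ih, wordValue_append, wordValue_singleton, hc, mul_zero, add_zero]
    · refine DFAO.generates_iff.1 hM _ _ ?_
      rw [wordValue, Nat.digits_ofDigits q hq]
      · exact map_val_lt _
      · simpa using hc

theorem mem_qKernel_section (a b : ℕ → β) (hb : b ∈ qKernel q a) (c : Fin q) :
    (fun n => b (q * n + c)) ∈ qKernel q a := by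
  obtain ⟨e, r, hr, rfl⟩ := hb
  refine ⟨e + 1, q ^ e * c + r, ?_, ?_⟩
  · have : q ^ e * (c + 1) ≤ q ^ e * q := Nat.mul_le_mul_left _ c.2
    rw [pow_succ]
    rw [mul_add, mul_one] at this
    omega
  · ext n
    change a _ = a _
    congr 1
    ring

theorem self_mem_qKernel (a : ℕ → β) : a ∈ qKernel q a := ⟨0, 0, by simp, by simp⟩

/-- The automaton whose states are the elements of the `q`-kernel of `a`. -/
def kernelAutomaton (q : ℕ) (a : ℕ → β) : DFAO q β (qKernel q a) where
  start := ⟨a, self_mem_qKernel a⟩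
  step b c := ⟨fun n => b.1 (q * n + c), mem_qKernel_section a b.1 b.2 c⟩
  out b := b.1 0

theorem kernelAutomaton_foldl (a : ℕ → β) (w : List (Fin q)) (n : ℕ) :
    (w.foldl (kernelAutomaton q a).step (kernelAutomaton q a).start).1 n
      = a (q ^ w.length * n + wordValue w) := by
  induction w using List.reverseRecOn generalizing n with
  | nil => simp [kernelAutomaton, wordValue]
  | append_singleton w c ih =>
    rw [List.foldl_append, List.foldl_cons, List.foldl_nil]
    change (w.foldl (kernelAutomaton q a).step (kernelAutomaton q a).start).1 (q * n + c) = _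
    rw [ih, wordValue_append, wordValue_singleton, List.length_append, List.length_singleton]
    congr 1
    ring

theorem kernelAutomaton_output (a : ℕ → β) (w : List (Fin q)) :
    (kernelAutomaton q a).output w = a (wordValue w) := by
  change (w.foldl (kernelAutomaton q a).step (kernelAutomaton q a).start).1 0 = _
  rw [kernelAutomaton_foldl, mul_zero, zero_add]

/-- The automaton `M` with its states renamed along `e`. -/
def DFAO.relabel {σ τ : Type*} (M : DFAO q β σ) (e : σ ≃ τ) : DFAO q β τ where
  start := e M.start
  step s c := e (M.step (e.symm s) c)
  out s := M.out (e.symm s)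

theorem DFAO.relabel_output {σ τ : Type*} (M : DFAO q β σ) (e : σ ≃ τ) (w : List (Fin q)) :
    (M.relabel e).output w = M.output w := by
  have h : ∀ s, w.foldl (M.relabel e).step (e s) = e (w.foldl M.step s) := by
    induction w with
    | nil => intro s; rfl
    | cons c w ih =>
      intro s
      rw [List.foldl_cons, List.foldl_cons, ← ih]
      simp [DFAO.relabel]
  change M.out (e.symm (w.foldl (M.relabel e).step (e M.start))) = _
  rw [h, e.symm_apply_apply, DFAO.output]

/-- Every automaton that generates `a` and ignores leading zeros has at least as many states as
the `q`-kernel of `a` has elements. -/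
theorem qKernel_encard_le {τ : Type*} [Fintype τ] (hq : 1 < q) {a : ℕ → β} {N : DFAO q β τ}
    (hN : N.Generates a) (hz : N.IgnoresLeadingZeros) :
    (qKernel q a).encard ≤ Fintype.card τ := by
  -- The state reached on a word of length e and value r computes the kernel element of e and r; a
  -- state determines that sequence, so the assignment is injective.
  have key : ∀ b ∈ qKernel q a, ∃ s : τ, ∀ (w : List (Fin q)),
      N.out (w.foldl N.step s) = b (wordValue w) := by
    rintro b ⟨e, r, hr, rfl⟩
    obtain ⟨v, rfl, rfl⟩ := exists_word hq e r hr
    refine ⟨v.foldl N.step N.start, fun w => ?_⟩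
    have := DFAO.output_eq_of_generates hq hN hz (v ++ w)
    rw [DFAO.output, List.foldl_append, wordValue_append] at this
    rw [this, add_comm]
  have : Nonempty τ := ⟨N.start⟩
  choose! f hf using key
  have hinj : Set.InjOn f (qKernel q a) := by
    intro b hb b' hb' h
    ext n
    -- Length n suffices for a word of value n, as n < q^n.
    obtain ⟨w, -, rfl⟩ := exists_word hq n n (Nat.lt_pow_self hq)
    rw [← hf b hb, ← hf b' hb', h]
  calc (qKernel q a).encard = (f '' qKernel q a).encard := hinj.encard_image.symm
    _ ≤ (Set.univ : Set τ).encard := Set.encard_le_encard (Set.subset_univ _)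
    _ = Fintype.card τ := by simp [Set.encard_univ]

theorem exists_isMinimalFor (hq : 1 < q) (a : ℕ → β) {m : ℕ} (hm : (qKernel q a).encard = m) :
    ∃ M : DFAO q β (Fin m), M.IsMinimalFor a := by
  have hfin : (qKernel q a).Finite := Set.finite_of_encard_eq_coe hm
  have := hfin.to_subtype
  have hcard : Nat.card (qKernel q a) = m := by
    rw [Nat.card_coe_set_eq, Set.ncard, hm, ENat.toNat_natCast]
  let e : qKernel q a ≃ Fin m := Finite.equivFinOfCardEq hcard
  have hout : ∀ w, ((kernelAutomaton q a).relabel e).output w = a (wordValue w) := fun w => by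
    rw [DFAO.relabel_output, kernelAutomaton_output]
  refine ⟨(kernelAutomaton q a).relabel e, DFAO.generates_iff.2 ?_, ?_, ?_⟩
  · intro n w hw
    rw [hout, wordValue, hw, Nat.ofDigits_digits]
  · intro w z k hz
    rw [hout, hout, wordValue_append]
    simp [wordValue, hz]
  · intro τ _ N hN hNz
    have := qKernel_encard_le hq hN hNz
    rw [hm] at this
    simpa using this

end MinimalAutomata

/-! ### Counting numerators -/

section Counting

theorem encard_image_le_card {ι α β : Type*} [Fintype β] (s : Set ι) (G : ι → α) (f : ι → β)
    (h : ∀ n ∈ s, ∀ m ∈ s, f n = f m → G n = G m) : (G '' s).encard ≤ Fintype.card β := by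
  choose g hg using fun y : G '' s => y.2
  have hinj : Function.Injective fun y => f (g y) := by
    intro y z hyz
    have := h _ (hg y).1 _ (hg z).1 hyz
    rw [(hg y).2, (hg z).2] at this
    exact Subtype.ext this
  rw [Set.encard, ← ENat.card_eq_coe_fintype_card]
  exact ENat.card_le_card_of_injective hinj

theorem eq_of_mod_eq_of_eventually_periodic {α : Type*} {g : ℕ → α} {t L : ℕ}
    (hg : ∀ n, t ≤ n → g (n + L) = g n) {n m : ℕ} (hn : t ≤ n) (hm : t ≤ m)
    (h : n % L = m % L) : g n = g m := by
  have key : ∀ c n, t ≤ n → g (n + L * c) = g n := by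
    intro c
    induction c with
    | zero => intro n _; rfl
    | succ c ih => intro n hn; rw [mul_add_one, ← add_assoc, hg _ (by omega), ih n hn]
  wlog hle : n ≤ m generalizing n m
  · exact (this hm hn h.symm (by omega)).symm
  obtain ⟨c, hc⟩ := (Nat.modEq_iff_dvd' hle).1 h
  rw [show m = n + L * c by omega, key c n hn]

variable {K : Type*} [Field K] [Fintype K]

open Polynomial.Bivariate

theorem encard_bidegreeLE_le {h d : ℕ} (hh : 1 ≤ h) (hd : 1 ≤ d) :
    {S : Polynomial (Polynomial K) | BidegreeLE (h - 1) (d - 1) S}.encard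
      ≤ (Fintype.card K ^ (h * d) : ℕ) := by
  have := encard_image_le_card {S : Polynomial (Polynomial K) | BidegreeLE (h - 1) (d - 1) S} id
    (fun S (x : Fin h × Fin d) => (S.coeff x.2).coeff x.1) ?_
  · simpa using this
  · intro S hS T hT hST
    ext j i
    by_cases hij : h - 1 < i ∨ d - 1 < j
    · rw [id, id, hS.coeff_coeff hij, hT.coeff_coeff hij]
    · exact congrFun hST (⟨i, by omega⟩, ⟨j, by omega⟩)

/-- A sequence of polynomials whose coefficients of `x⁰`, `xʰ` and `y^{d-1}` are eventually periodic
takes few values. -/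
theorem encard_range_le_of_border_periodic {h d t L : ℕ} (hL : 0 < L)
    {G : ℕ → Polynomial (Polynomial K)} (hdeg : ∀ n, t ≤ n → BidegreeLE h (d - 1) (G n))
    (hleft : ∀ n, t ≤ n → (swap (G (n + L))).coeff 0 = (swap (G n)).coeff 0)
    (hright : ∀ n, t ≤ n → (swap (G (n + L))).coeff h = (swap (G n)).coeff h)
    (htop : ∀ n, t ≤ n → (G (n + L)).coeff (d - 1) = (G n).coeff (d - 1)) :
    (Set.range G).encard ≤ (t + L * Fintype.card K ^ ((h - 1) * (d - 1)) : ℕ) := by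
  have hsplit : Set.range G ⊆ G '' (Finset.range t : Set ℕ) ∪ G '' Set.Ici t := by
    rintro _ ⟨n, rfl⟩
    by_cases hn : n < t
    · exact Or.inl ⟨n, by simpa using hn, rfl⟩
    · exact Or.inr ⟨n, not_lt.1 hn, rfl⟩
  have h1 : (G '' (Finset.range t : Set ℕ)).encard ≤ t := by
    refine (Set.encard_image_le _ _).trans ?_
    rw [Set.encard_coe_eq_coe_finsetCard, Finset.card_range]
  have h2 : (G '' Set.Ici t).encard ≤ (L * Fintype.card K ^ ((h - 1) * (d - 1)) : ℕ) := by
    -- The class n mod L fixes the three borders; the interior consists of x-exponents 1, …, h - 1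
    -- (hence the shift by one) and y-exponents 0, …, d - 2.
    have := encard_image_le_card (Set.Ici t) G (fun n => ((⟨n % L, Nat.mod_lt _ hL⟩ : Fin L),
      fun x : Fin (h - 1) × Fin (d - 1) => ((G n).coeff x.2).coeff (x.1 + 1))) ?_
    · simpa using this
    · intro n hn m hm hnm
      obtain ⟨hmod, hint⟩ := Prod.mk.inj hnm
      have hmod : n % L = m % L := congrArg Fin.val hmod
      ext j i
      by_cases hij : h < i ∨ d - 1 < j
      · rw [(hdeg n hn).coeff_coeff hij, (hdeg m hm).coeff_coeff hij]
      by_cases hi0 : i = 0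
      · subst hi0
        rw [← coeff_coeff_swap (G n), ← coeff_coeff_swap (G m),
          eq_of_mod_eq_of_eventually_periodic (g := fun n => (swap (G n)).coeff 0) hleft hn hm hmod]
      by_cases hih : i = h
      · subst hih
        rw [← coeff_coeff_swap (G n), ← coeff_coeff_swap (G m),
          eq_of_mod_eq_of_eventually_periodic (g := fun n => (swap (G n)).coeff i) hright hn hm hmod]
      by_cases hjd : j = d - 1
      · subst hjd
        rw [eq_of_mod_eq_of_eventually_periodic (g := fun n => (G n).coeff (d - 1)) htop hn hm hmod]
      have := congrFun hint (⟨i - 1, by omega⟩, ⟨j, by omega⟩)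
      simpa [Nat.sub_add_cancel (Nat.one_le_iff_ne_zero.2 hi0)] using this
  refine (Set.encard_le_encard hsplit).trans ((Set.encard_union_le _ _).trans ?_)
  rw [Nat.cast_add]
  exact add_le_add h1 h2

end Counting

/-! ### The bound for Furstenberg series -/

section FurstenbergSeries

theorem lcm_partitionLcm_le_maxLcm {l m n : ℕ} (hl : 1 ≤ l) (hm : 1 ≤ m) (hn : 1 ≤ n)
    (σ₁ : l.Partition) (σ₂ : m.Partition) (σ₃ : n.Partition) :
    Nat.lcm (Nat.lcm (partitionLcm σ₁) (partitionLcm σ₂)) (partitionLcm σ₃) ≤ maxLcm l m n := by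
  refine le_trans ?_ (Finset.le_sup (Finset.mem_Icc.2 ⟨hl, le_rfl⟩))
  refine le_trans ?_ (Finset.le_sup (Finset.mem_Icc.2 ⟨hm, le_rfl⟩))
  refine le_trans ?_ (Finset.le_sup (Finset.mem_Icc.2 ⟨hn, le_rfl⟩))
  refine le_trans ?_ (Finset.le_sup (Finset.mem_univ σ₁))
  refine le_trans ?_ (Finset.le_sup (Finset.mem_univ σ₂))
  exact Finset.le_sup (f := fun σ₃ => Nat.lcm (Nat.lcm (partitionLcm σ₁) (partitionLcm σ₂))
    (partitionLcm σ₃)) (Finset.mem_univ σ₃)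

variable {K : Type*} [Field K]

open Polynomial.Bivariate

theorem evalEval_zero_zero (S : Polynomial (Polynomial K)) :
    Polynomial.evalEval 0 0 S = (S.coeff 0).coeff 0 := by
  rw [Polynomial.evalEval, map_zero, ← Polynomial.coeff_zero_eq_eval_zero,
    ← Polynomial.coeff_zero_eq_eval_zero]

theorem IsFurstenbergSeries.coeff_one_ne_zero {P : Polynomial (Polynomial K)} {F : PowerSeries K}
    (hF : IsFurstenbergSeries P F) : (P.coeff 1).coeff 0 ≠ 0 := by
  have := hF.eval_derivative_ne_zero
  rw [evalEval_zero_zero, Polynomial.coeff_derivative] at this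
  simpa using this

theorem IsFurstenbergSeries.one_le_natDegree {P : Polynomial (Polynomial K)} {F : PowerSeries K}
    (hF : IsFurstenbergSeries P F) : 1 ≤ P.natDegree :=
  Polynomial.le_natDegree_of_ne_zero fun h => hF.coeff_one_ne_zero (by simp [h])

/-- If h = 0, then P = y G with G(F) = 0, because F ≠ 0. The constant term of G(F) is ∂P/∂y(0, 0), a
contradiction. -/
theorem IsFurstenbergSeries.one_le_polyHeight {P : Polynomial (Polynomial K)} {F : PowerSeries K}
    (hF : IsFurstenbergSeries P F) (hF0 : F ≠ 0) : 1 ≤ polyHeight P := by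
  by_contra hh
  have hbi := bidegreeLE_polyHeight P
  have hP0 : P.coeff 0 = 0 := by
    ext i
    rcases Nat.eq_zero_or_pos i with rfl | hi
    · rw [← evalEval_zero_zero, hF.eval_zero, Polynomial.coeff_zero]
    · rw [hbi.coeff_coeff (Or.inl (by omega)), Polynomial.coeff_zero]
  obtain ⟨G, hG⟩ := Polynomial.X_dvd_iff.2 hP0
  have h1 : evalAtSeries G F = 0 := by
    have := hF.root
    rw [hG, evalAtSeries, Polynomial.eval₂_mul, Polynomial.eval₂_X] at this
    exact (mul_eq_zero.1 this).resolve_left hF0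
  apply hF.coeff_one_ne_zero
  rw [hG, Polynomial.coeff_X_mul, ← evalEval_zero_zero,
    ← constantCoeff_evalAtSeries G hF.constantCoeff_eq_zero, h1, map_zero]

theorem bidegreeLE_X_mul_derivative {P : Polynomial (Polynomial K)} {h d : ℕ}
    (hP : BidegreeLE h d P) : BidegreeLE h d (Polynomial.X * Polynomial.derivative P) := by
  refine bidegreeLE_of_coeff fun i j hij => ?_
  cases j with
  | zero => simp
  | succ j =>
    rw [Polynomial.coeff_X_mul, Polynomial.coeff_derivative, ← Nat.cast_succ,
      Polynomial.coeff_mul_natCast, hP.coeff_coeff hij, zero_mul]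

theorem iterate_cartierTransform_periodic_of_natDegree_dvd [Fintype K] {q : ℕ} [NeZero q]
    (hcard : Fintype.card K = q) {p u : Polynomial K} (hp : p ≠ 0) {k e : ℕ} (he : e ≠ 0)
    (hpe : ∀ π, Irreducible π → π ∣ p → π.natDegree ∣ e) (hpk : p.natDegree ≤ q ^ k)
    (hu : u.natDegree + 1 < p.natDegree + q ^ k) {n : ℕ} (hn : k ≤ n) :
    (cartierTransform q (AddMonoidHom.id K) p)^[n + e] u
      = (cartierTransform q (AddMonoidHom.id K) p)^[n] u := by
  subst hcard
  refine iterate_cartierTransform_periodic FiniteField.pow_card (powAdditive_of_algebra K _)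
    Fintype.one_lt_card he ?_ hu hn
  refine dvd_pow_of_forall_irreducible_dvd hp hpk fun π hπ hd => ?_
  rw [← Nat.card_eq_fintype_card]
  exact hπ.natDegree_dvd_iff_dvd_X_pow_card_pow_sub_X.1 (hpe π hπ hd)

theorem encard_orbit_le [Fintype K] {q h d k : ℕ} [NeZero q] (hcard : Fintype.card K = q)
    {P S : Polynomial (Polynomial K)} (hP : BidegreeLE h d P) (hPh : (swap P).coeff h ≠ 0)
    (hP0 : (swap P).coeff 0 ≠ 0) (hPd : P.coeff d ≠ 0) (hh : 1 ≤ h) (hd : 1 ≤ d)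
    (hhk : h < q ^ k) (hdk : d < q ^ k) (hS : BidegreeLE h d S) :
    (Set.range fun n => (stateStep q 0 P)^[n] S).encard
      ≤ (k + 1 + maxLcm h d d * q ^ ((h - 1) * (d - 1)) : ℕ) := by
  have hq : 1 < q := hcard ▸ Fintype.one_lt_card
  have hdegP : ∀ i, ((swap P).coeff i).natDegree ≤ d := fun i => by
    rw [Polynomial.natDegree_le_iff_coeff_eq_zero]
    intro j hj
    rw [coeff_coeff_swap, hP.coeff_coeff (Or.inr hj)]
  have hPdh : (P.coeff d).natDegree ≤ h := by
    rw [Polynomial.natDegree_le_iff_coeff_eq_zero]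
    exact fun i hi => hP.coeff_coeff (Or.inl hi)
  obtain ⟨σ₁, hσ₁⟩ := exists_partition_natDegree_dvd hPd hPdh
  obtain ⟨σ₂, hσ₂⟩ := exists_partition_natDegree_dvd hP0 (hdegP 0)
  obtain ⟨σ₃, hσ₃⟩ := exists_partition_natDegree_dvd hPh (hdegP h)
  set L := Nat.lcm (Nat.lcm (partitionLcm σ₁) (partitionLcm σ₂)) (partitionLcm σ₃) with hLdef
  have hL : 0 < L := Nat.lcm_pos (Nat.lcm_pos (partitionLcm_pos _) (partitionLcm_pos _))
    (partitionLcm_pos _)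
  have hLle : L ≤ maxLcm h d d := lcm_partitionLcm_le_maxLcm hh hd hd σ₁ σ₂ σ₃
  have hd₁ : partitionLcm σ₁ ∣ L := (Nat.dvd_lcm_left _ _).trans (Nat.dvd_lcm_left _ _)
  have hd₂ : partitionLcm σ₂ ∣ L := (Nat.dvd_lcm_right _ _).trans (Nat.dvd_lcm_left _ _)
  have hd₃ : partitionLcm σ₃ ∣ L := Nat.dvd_lcm_right _ _
  have hqh : h + (q - 1) * h < q * (h + 1) + 0 := by
    have : q * h = (q - 1) * h + h := by
      rw [← Nat.succ_mul, Nat.succ_eq_add_one, Nat.sub_add_cancel hq.le]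
    rw [mul_add]
    omega
  have hqd : d + (q - 1) * d < q * (d - 1 + 1) + (q - 1) := by
    have : q * d = (q - 1) * d + d := by
      rw [← Nat.succ_mul, Nat.succ_eq_add_one, Nat.sub_add_cancel hq.le]
    rw [Nat.sub_add_cancel hd]
    omega
  set S₁ := stateStep q 0 P S with hS₁def
  have hS₁ : BidegreeLE h (d - 1) S₁ := bidegreeLE_stateStep hP hS hqh hqd
  have hdeg : ∀ n, BidegreeLE h (d - 1) ((stateStep q 0 P)^[n] S₁) := by
    intro n
    induction n with
    | zero => exact hS₁
    | succ n ih =>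
      rw [Function.iterate_succ_apply']
      exact bidegreeLE_stateStep hP (ih.mono le_rfl (by omega)) hqh hqd
  have hleft : ∀ n, (swap ((stateStep q 0 P)^[n] S₁)).coeff 0
      = (cartierTransform q (AddMonoidHom.id K) ((swap P).coeff 0))^[n] ((swap S₁).coeff 0) := by
    intro n
    induction n with
    | zero => rfl
    | succ n ih =>
      rw [Function.iterate_succ_apply', Function.iterate_succ_apply', swap_stateStep_coeff_zero, ih]
  have hright : ∀ n, (swap ((stateStep q 0 P)^[n] S₁)).coeff h
      = (cartierTransform q (AddMonoidHom.id K) ((swap P).coeff h))^[n] ((swap S₁).coeff h) := by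
    intro n
    induction n with
    | zero => rfl
    | succ n ih =>
      rw [Function.iterate_succ_apply', Function.iterate_succ_apply',
        swap_stateStep_coeff_top hP (hdeg n), ih]
  have htop : ∀ n, ((stateStep q 0 P)^[n] S₁).coeff (d - 1)
      = (cartierTransform q (AddMonoidHom.id K) (Polynomial.X * P.coeff d))^[n]
        (S₁.coeff (d - 1)) := by
    intro n
    induction n with
    | zero => rfl
    | succ n ih =>
      rw [Function.iterate_succ_apply', Function.iterate_succ_apply',
        stateStep_coeff_top hd hP (hdeg n), ih]
  have hdegS : ∀ i, ((swap S₁).coeff i).natDegree ≤ d - 1 := fun i => by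
    rw [Polynomial.natDegree_le_iff_coeff_eq_zero]
    intro j hj
    rw [coeff_coeff_swap, hS₁.coeff_coeff (Or.inr hj)]
  have hdegS' : (S₁.coeff (d - 1)).natDegree ≤ h := by
    rw [Polynomial.natDegree_le_iff_coeff_eq_zero]
    exact fun i hi => hS₁.coeff_coeff (Or.inl hi)
  have hXdeg : (Polynomial.X * P.coeff d).natDegree = (P.coeff d).natDegree + 1 :=
    Polynomial.natDegree_X_mul hPd
  -- The extra factor X has degree 1, so it does not affect the period.
  have hXdvd : ∀ π, Irreducible π → π ∣ Polynomial.X * P.coeff d → π.natDegree ∣ L := by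
    intro π hπ hdvd
    rcases hπ.prime.dvd_or_dvd hdvd with hdvd | hdvd
    · have := Polynomial.natDegree_le_of_dvd hdvd Polynomial.X_ne_zero
      rw [Polynomial.natDegree_X] at this
      rw [le_antisymm this hπ.natDegree_pos]
      exact one_dvd _
    · exact (hσ₁ π hπ hdvd).trans hd₁
  -- The transient is one step to bring the y-degree down to d - 1, then k steps for the borders to
  -- become periodic.
  have hbound := encard_range_le_of_border_periodic (h := h) (d := d) (t := k + 1) hL
    (G := fun n => (stateStep q 0 P)^[n] S) ?_ ?_ ?_ ?_
  · refine hbound.trans ?_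
    rw [hcard]
    exact_mod_cast Nat.add_le_add_left (Nat.mul_le_mul_right _ hLle) _
  all_goals
    intro n hn
    obtain ⟨m, rfl⟩ : ∃ m, n = m + 1 := ⟨n - 1, by omega⟩
  · exact hdeg m
  · simp only [add_right_comm m 1 L, Function.iterate_succ_apply, ← hS₁def]
    rw [hleft, hleft]
    have := hdegS 0
    have := hdegP 0
    exact iterate_cartierTransform_periodic_of_natDegree_dvd hcard hP0 hL.ne'
      (fun π hπ hdvd => (hσ₂ π hπ hdvd).trans hd₂) (by omega) (by omega) (by omega : k ≤ m)
  · simp only [add_right_comm m 1 L, Function.iterate_succ_apply, ← hS₁def]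
    rw [hright, hright]
    have := hdegS h
    have := hdegP h
    exact iterate_cartierTransform_periodic_of_natDegree_dvd hcard hPh hL.ne'
      (fun π hπ hdvd => (hσ₃ π hπ hdvd).trans hd₃) (by omega) (by omega) (by omega : k ≤ m)
  · simp only [add_right_comm m 1 L, Function.iterate_succ_apply, ← hS₁def]
    rw [htop, htop]
    exact iterate_cartierTransform_periodic_of_natDegree_dvd hcard
      (mul_ne_zero Polynomial.X_ne_zero hPd) hL.ne' hXdvd (by omega) (by omega) (by omega : k ≤ m)

theorem encard_qKernel_le [Fintype K] {q k : ℕ} (hcard : Fintype.card K = q)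
    {P : Polynomial (Polynomial K)} {F : PowerSeries K} (hF : IsFurstenbergSeries P F)
    (hF0 : F ≠ 0) (hhk : polyHeight P < q ^ k) (hdk : P.natDegree < q ^ k) :
    (qKernel q fun n => PowerSeries.coeff n F).encard
      ≤ (q ^ (polyHeight P * P.natDegree) + (k + 1 + maxLcm (polyHeight P) P.natDegree P.natDegree
        * q ^ ((polyHeight P - 1) * (P.natDegree - 1))) : ℕ) := by
  have hq : 1 < q := hcard ▸ Fintype.one_lt_card
  have : NeZero q := ⟨by omega⟩
  have hh := hF.one_le_polyHeight hF0
  have hd := hF.one_le_natDegree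
  have hP := bidegreeLE_polyHeight P
  have hPne : P ≠ 0 := by
    rintro rfl
    simp at hd
  have hP0 : (swap P).coeff 0 ≠ 0 := fun h => hF.coeff_one_ne_zero (by
    rw [← coeff_coeff_swap, h, Polynomial.coeff_zero])
  have hPh := coeff_swap_polyHeight_ne_zero hPne
  have hPd : P.coeff P.natDegree ≠ 0 := Polynomial.leadingCoeff_ne_zero.2 hPne
  obtain ⟨c, hc⟩ := exists_inverse_evalAtSeries_derivative hF
  set h := polyHeight P
  set d := P.natDegree
  have hqh : q * h = (q - 1) * h + h := by
    rw [← Nat.succ_mul, Nat.succ_eq_add_one, Nat.sub_add_cancel hq.le]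
  have hqd : q * d = (q - 1) * d + d := by
    rw [← Nat.succ_mul, Nat.succ_eq_add_one, Nat.sub_add_cancel hq.le]
  -- Furstenberg's numerator y P_y: its value at F divided by P_y(F) is F.
  set S₀ := Polynomial.X * Polynomial.derivative P with hS₀def
  have hS₀ : BidegreeLE h d S₀ := bidegreeLE_X_mul_derivative hP
  have horbit : ∀ n, BidegreeLE h d ((stateStep q 0 P)^[n] S₀) := by
    intro n
    induction n with
    | zero => exact hS₀
    | succ n ih =>
      rw [Function.iterate_succ_apply']
      exact bidegreeLE_stateStep hP ih (by rw [mul_add]; omega) (by rw [mul_add]; omega)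
  have hsub := qKernel_subset_image (P := P) (F := F) (c := c)
    (X := {S | BidegreeLE (h - 1) (d - 1) S} ∪ Set.range fun n => (stateStep q 0 P)^[n] S₀) ?_
    (fun r hr S => seriesSection_residue hq (hcard ▸ FiniteField.pow_card)
      (hcard ▸ powAdditive_of_algebra K _) (hcard ▸ powAdditive_of_algebra K _) hF hc hr S)
    (S₀ := S₀) (Or.inr ⟨0, rfl⟩) ?_
  · refine (Set.encard_le_encard hsub).trans ((Set.encard_image_le _ _).trans
      ((Set.encard_union_le _ _).trans ?_))
    rw [Nat.cast_add]
    refine add_le_add ?_ (encard_orbit_le hcard hP hPh hP0 hPd hh hd hhk hdk hS₀)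
    rw [← hcard]
    exact encard_bidegreeLE_le hh hd
  · rintro S (hS | ⟨n, rfl⟩) r hr
    · exact Or.inl (bidegreeLE_stateStep hP hS (by rw [Nat.sub_add_cancel hh]; omega)
        (by rw [Nat.sub_add_cancel hd]; omega))
    · rcases Nat.eq_zero_or_pos r with rfl | hr0
      · exact Or.inr ⟨n + 1, Function.iterate_succ_apply' _ _ _⟩
      -- The x-degree drops to h - 1 because h + (q - 1)h = qh < qh + r, which needs r > 0.
      · exact Or.inl (bidegreeLE_stateStep hP (horbit n) (by rw [Nat.sub_add_cancel hh]; omega)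
          (by rw [Nat.sub_add_cancel hd]; omega))
  · rw [hS₀def, evalAtSeries, Polynomial.eval₂_mul, Polynomial.eval₂_X, mul_assoc]
    exact (congrArg (F * ·) hc).trans (mul_one F)

end FurstenbergSeries

/-- The two extra powers of q supply a factor of at least 4. With m = max(h, d - 1) ≥ 1, both h and
d ≤ m + 1 lie below 4m. -/
theorem lt_pow_ceil_logb_add_two {q m n : ℕ} (hq : 1 < q) (hm : 1 ≤ m) (hn : n < 4 * m) :
    n < q ^ (⌈Real.logb q m⌉₊ + 2) := by
  have hq' : (1 : ℝ) < q := by exact_mod_cast hq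
  have h1 : m ≤ q ^ ⌈Real.logb q m⌉₊ := by
    have h2 : (m : ℝ) ≤ (q : ℝ) ^ ((⌈Real.logb q m⌉₊ : ℕ) : ℝ) :=
      (Real.logb_le_iff_le_rpow hq' (by exact_mod_cast hm)).1 (Nat.le_ceil _)
    rw [Real.rpow_natCast] at h2
    exact_mod_cast h2
  have h3 : 2 ^ 2 ≤ q ^ 2 := Nat.pow_le_pow_left hq 2
  rw [pow_add]
  have := Nat.mul_le_mul h1 h3
  omega

theorem theorem1 {K : Type*} [Field K] [Fintype K] (q h d : ℕ) (hq : Fintype.card K = q)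
    (P : Polynomial (Polynomial K)) (hh : polyHeight P = h) (hd : P.natDegree = d)
    (F : PowerSeries K) (hF : IsFurstenbergSeries P F) (hF0 : F ≠ 0) :
    ∃ (m : ℕ) (M : DFAO q K (Fin m)),
      M.IsMinimalFor (fun n => PowerSeries.coeff n F) ∧
      (qKernel q (fun n => PowerSeries.coeff n F)).encard = m ∧
      m ≤ q ^ (h * d) + q ^ ((h - 1) * (d - 1)) * maxLcm h d d
        + ⌊Real.logb q h⌋₊ + ⌈Real.logb q (max h (d - 1) : ℕ)⌉₊ + 3 := by
  have hq1 : 1 < q := hq ▸ Fintype.one_lt_card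
  have hh1 := hF.one_le_polyHeight hF0
  have hd1 := hF.one_le_natDegree
  have hle := encard_qKernel_le hq hF hF0
    (lt_pow_ceil_logb_add_two (m := max (polyHeight P) (P.natDegree - 1)) hq1 (by omega) (by omega))
    (lt_pow_ceil_logb_add_two (m := max (polyHeight P) (P.natDegree - 1)) hq1 (by omega) (by omega))
  subst hh hd
  obtain ⟨m, hm⟩ := ENat.ne_top_iff_exists.1 (ne_top_of_le_ne_top (ENat.natCast_ne_top _) hle)
  obtain ⟨M, hM⟩ := exists_isMinimalFor hq1 _ hm.symm
  refine ⟨m, M, hM, hm.symm, ?_⟩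
  rw [← hm, Nat.cast_le] at hle
  rw [mul_comm (q ^ ((polyHeight P - 1) * (P.natDegree - 1)))]
  -- Here k + 1 = ⌈log_q max(h, d - 1)⌉ + 3, so the bound holds even without the term ⌊log_q h⌋.
  omega
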